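/- Let $(X_n)_{n\ge 0}$ be a Galton--Watson process with immigration, i.e. $$X_n=\sum_{i=1}^{X_{n-1}}\xi_{n,i}+\varepsilon_n,\qquad n\ge 1,$$ where $\{X_0,\xi_{n,i},\varepsilon_n : n,i\ge 1\}$ are independent non-negative integer-valued random variables on a probability space $(\Omega,\mathcal A,\mathbb P)$, the $\xi_{n,i}$ ($n,i\ge1$) are identically distributed, the $\varepsilon_n$ ($n\ge1$) are identically distributed, and $\sum_{i=1}^0:=0$. Let $\xi:=\xi_{1,1}$, $\varepsilon:=\varepsilon_1$ and $m_\xi:=\mathbb E(\xi)$. A non-negative random variable $Y$ is called regularly varying with index $\alpha\in[0,\infty)$ if $\mathbb P(Y>x)>0$ for all $x>0$ and $\lim_{x\to\infty}\mathbb P(Y>qx)/\mathbb P(Y>x)=q^{-\alpha}$ for all $q>0$. Suppose that $\varepsilon$ is regularly varying with index $\gamma\in[0,\infty)$, that $\mathbb P(\xi=0)<1$, and that there exists $r\in(\max(1,\gamma),\infty)$ with $\mathbb E(\xi^r)<\infty$ and $\mathbb E(X_0^r)<\infty$. Then for each integer $n\ge 1$, $$\mathbb P(X_n>x)\sim\sum_{i=1}^n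 m_\xi^{(n-i)\gamma}\,\mathbb P(\varepsilon>x)\qquad\text{as }x\to\infty,$$ i.e. the ratio of the two sides tends to $1$; and hence $X_n$ is also regularly varying with index $\gamma$. -/

import Mathlib

open Filter MeasureTheory ProbabilityTheory
open scoped Topology Asymptotics

/-- `U`, viewed as a function on the positive half-line, is a measurable positive function which is
regularly varying at infinity with index `ρ`: `U (q x) / U x → q ^ ρ` as `x → ∞`, for all `q > 0`.
The values of `U` outside `(0, ∞)` play no role. -/
def RegularlyVaryingAtTop (U : ℝ → ℝ) (ρ : ℝ) : Prop :=
  (Measurable fun x : Set.Ioi (0 : ℝ) => U x) ∧ (∀ x : ℝ, 0 < x → 0 < U x) ∧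
    ∀ q : ℝ, 0 < q → Tendsto (fun x : ℝ => U (q * x) / U x) atTop (𝓝 (q ^ ρ))

/-- A non-negative random variable `Y` is regularly varying with index `α ≥ 0` if its tail
`x ↦ P(Y > x)` is positive on `(0, ∞)` and regularly varying at infinity with index `-α`. -/
def RegularlyVaryingRV {Ω : Type*} [MeasurableSpace Ω] (P : Measure Ω) (Y : Ω → ℝ) (α : ℝ) : Prop :=
  (∀ᵐ ω ∂P, 0 ≤ Y ω) ∧ RegularlyVaryingAtTop (fun x : ℝ => P.real {ω | x < Y ω}) (-α)

/-- Labels of the random variables `X₀`, `ξ_{n,i}`, `ε_n` with `n, i ≥ 1`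
driving a Galton-Watson process with immigration. -/
inductive GWILabel : Type
  | initial : GWILabel
  | offspring (n i : ℕ+) : GWILabel
  | immigration (n : ℕ+) : GWILabel

/-- The family `{X₀, ξ_{n,i}, ε_n : n, i ≥ 1}`. -/
def gwiFamily {Ω : Type*} (X₀ : Ω → ℕ) (ξ : ℕ → ℕ → Ω → ℕ) (ε : ℕ → Ω → ℕ) :
    GWILabel → Ω → ℕ
  | .initial => X₀
  | .offspring n i => ξ n i
  | .immigration n => ε n

/-- `X` is a Galton-Watson process with immigration, with offspring variables `ξ n i` and
immigration variables `ε n`, `n, i ≥ 1` (the values of `ξ` and `ε` at index `0` play no role):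
`X_n = ∑_{i=1}^{X_{n-1}} ξ_{n,i} + ε_n` for `n ≥ 1`, where `X₀`, `ξ_{n,i}`, `ε_n` are independent,
the `ξ_{n,i}` are identically distributed, and so are the `ε_n`. -/
structure IsGaltonWatsonWithImmigration {Ω : Type*} [MeasurableSpace Ω] (P : Measure Ω)
    (X : ℕ → Ω → ℕ) (ξ : ℕ → ℕ → Ω → ℕ) (ε : ℕ → Ω → ℕ) : Prop where
  measurable_process : ∀ n, Measurable (X n)
  measurable_offspring : ∀ n i, 1 ≤ n → 1 ≤ i → Measurable (ξ n i)
  measurable_immigration : ∀ n, 1 ≤ n → Measurable (ε n)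
  indep : iIndepFun (gwiFamily (X 0) ξ ε) P
  identDistrib_offspring : ∀ n i, 1 ≤ n → 1 ≤ i → IdentDistrib (ξ n i) (ξ 1 1) P P
  identDistrib_immigration : ∀ n, 1 ≤ n → IdentDistrib (ε n) (ε 1) P P
  recursion : ∀ n, 1 ≤ n →
    ∀ᵐ ω ∂P, X n ω = (∑ i ∈ Finset.Icc 1 (X (n - 1) ω), ξ n i ω) + ε n ω

/-! Write U for the tail of ε and m for the offspring mean. By induction P(X_n > x)/U(x) → a_n,
where a_0 = 0 and a_{n+1} = a_n m^γ + 1, which unrolls to the sum. The start is Markov's inequality,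
since x^(-r) = o(U) for r > γ. The step rests on two closure properties. Independent summands add
their ratios (`HasTailRatio.add`), because both being of order x has probability O(U²) = o(U). A sum
of Y i.i.d. copies of ζ, independent of Y, multiplies the ratio by m^γ (`HasTailRatio.random_sum`),
because it is close to mY when Y is large.

The upper bound for random sums is the hard part. With K ≈ (1-δ)x/m, exceeding x requires Y > K, or
a used summand above ηx, or K summands truncated at ηx reaching x. The first event gives the main
term as δ → 0; the third is O(x^(-N)) by a Chernoff bound (`isBigO_measureReal_sum_min_ge`). For the
second, the crude bound K P(ζ > ηx) = O(x^(1-r)) may fail to be o(U); keeping the probability P(Y >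
j) that summand j is used gains the missing power (`HasTailRatio.isLittleO_sum_tail_mul_tail`). -/

/-! ### Power bounds for regularly varying functions -/

/-- Halving brings x into [x₀, 2x₀] and never decreases f. This turns regular variation at the
single ratio 2 into power bounds. -/
theorem le_of_forall_two_mul_le {f : ℝ → ℝ} {x₀ B : ℝ} (hx₀ : 0 < x₀)
    (hf : ∀ x, x₀ ≤ x → f (2 * x) ≤ f x) (hB : ∀ x, x₀ ≤ x → x ≤ 2 * x₀ → f x ≤ B)
    {x : ℝ} (hx : x₀ ≤ x) : f x ≤ B := by
  have key : ∀ n : ℕ, ∀ x, x₀ ≤ x → x ≤ 2 ^ n * (2 * x₀) → f x ≤ B := by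
    intro n
    induction n with
    | zero => intro x h1 h2; exact hB x h1 (by simpa using h2)
    | succ n ih =>
      intro x h1 h2
      by_cases h : x ≤ 2 * x₀
      · exact hB x h1 h
      · push Not at h
        have h3 := hf (x / 2) (by linarith)
        rw [mul_div_cancel₀ x (two_ne_zero)] at h3
        exact h3.trans (ih _ (by linarith) (by rw [pow_succ] at h2; linarith))
  obtain ⟨n, hn⟩ := pow_unbounded_of_one_lt (x / (2 * x₀)) (one_lt_two)
  exact key n x hx ((div_le_iff₀ (by positivity)).1 hn.le)

theorem rpow_isLittleO_rpow_atTop {a b : ℝ} (hab : a < b) :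
    (fun x : ℝ => x ^ a) =o[atTop] fun x : ℝ => x ^ b := by
  refine Asymptotics.isLittleO_of_tendsto' ?_ ?_
  · filter_upwards [eventually_gt_atTop 0] with x hx h
    exact absurd h (Real.rpow_pos_of_pos hx b).ne'
  · refine (tendsto_rpow_neg_atTop (sub_pos.2 hab)).congr' ?_
    filter_upwards [eventually_gt_atTop 0] with x hx
    rw [← Real.rpow_sub hx, neg_sub]

namespace RegularlyVaryingAtTop

variable {U : ℝ → ℝ} {γ : ℝ}

/-- Since 2^(-γ) < 2^(-θ), doubling a large x does not increase x^θ U(x); monotonicity of U bounds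
it on one dyadic block. -/
theorem isBigO_rpow (hU : RegularlyVaryingAtTop U (-γ)) (hanti : Antitone U) {θ : ℝ}
    (hθ0 : 0 ≤ θ) (hθ : θ < γ) : U =O[atTop] fun x : ℝ => x ^ (-θ) := by
  obtain ⟨-, hpos, hlim⟩ := hU
  have h2 := hlim 2 two_pos
  have hlt : (2 : ℝ) ^ (-γ) < 2 ^ (-θ) :=
    Real.rpow_lt_rpow_of_exponent_lt one_lt_two (by linarith)
  obtain ⟨x₀, hx₀, hev⟩ := ((h2.eventually_lt_const hlt).and
    (eventually_gt_atTop 0)).exists_forall_of_atTop.imp fun a h => And.intro (h a le_rfl).2 h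
  have hb : ∀ x, x₀ ≤ x → x ^ θ * U x ≤ (2 * x₀) ^ θ * U x₀ := by
    intro x hx
    refine le_of_forall_two_mul_le (f := fun x => x ^ θ * U x) hx₀ ?_ ?_ hx
    · intro y hy
      obtain ⟨h, hy0⟩ := hev y hy
      rw [div_lt_iff₀ (hpos y hy0)] at h
      rw [Real.mul_rpow two_pos.le hy0.le]
      calc (2:ℝ) ^ θ * y ^ θ * U (2 * y) ≤ 2 ^ θ * y ^ θ * (2 ^ (-θ) * U y) := by gcongr
        _ = (2 ^ θ * 2 ^ (-θ)) * (y ^ θ * U y) := by ring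
        _ = y ^ θ * U y := by rw [← Real.rpow_add two_pos]; simp
    · intro y hy hy2
      have : 0 < y := hx₀.trans_le hy
      have := hpos y this
      gcongr
      exact hanti hy
  refine Asymptotics.IsBigO.of_bound ((2 * x₀) ^ θ * U x₀) ?_
  filter_upwards [eventually_ge_atTop x₀] with x hx
  have hx0 : 0 < x := hx₀.trans_le hx
  have := hb x hx
  rw [Real.norm_of_nonneg (hpos x hx0).le, Real.norm_of_nonneg (by positivity),
    Real.rpow_neg hx0.le, ← div_eq_mul_inv, le_div_iff₀ (by positivity)]
  linarith

theorem isLittleO_rpow (hU : RegularlyVaryingAtTop U (-γ)) (hanti : Antitone U) (hγ : 0 ≤ γ)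
    {ρ : ℝ} (hρ : γ < ρ) : (fun x : ℝ => x ^ (-ρ)) =o[atTop] U := by
  obtain ⟨-, hpos, hlim⟩ := hU
  have h2 := hlim 2 two_pos
  -- The doubling argument yields only a big-O, for x^(-σ); the gap σ < ρ upgrades it to little-o.
  obtain ⟨σ, hσ, hσρ⟩ := exists_between hρ
  have hlt : (2 : ℝ) ^ (-σ) < 2 ^ (-γ) :=
    Real.rpow_lt_rpow_of_exponent_lt one_lt_two (by linarith)
  obtain ⟨x₀, hx₀, hev⟩ := ((h2.eventually_const_lt hlt).and
    (eventually_gt_atTop 0)).exists_forall_of_atTop.imp fun a h => And.intro (h a le_rfl).2 h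
  have hb : ∀ x, x₀ ≤ x → x ^ (-σ) / U x ≤ x₀ ^ (-σ) / U (2 * x₀) := by
    intro x hx
    refine le_of_forall_two_mul_le (f := fun x => x ^ (-σ) / U x) hx₀ ?_ ?_ hx
    · intro y hy
      obtain ⟨h, hy0⟩ := hev y hy
      rw [lt_div_iff₀ (hpos y hy0)] at h
      have h1 := hpos y hy0
      rw [Real.mul_rpow two_pos.le hy0.le, div_le_div_iff₀ (hpos _ (by positivity)) h1]
      calc (2:ℝ) ^ (-σ) * y ^ (-σ) * U y = y ^ (-σ) * (2 ^ (-σ) * U y) := by ring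
        _ ≤ _ := by gcongr
    · intro y hy hy2
      have hy0 : 0 < y := hx₀.trans_le hy
      have h1 := hpos y hy0
      have h2 := hpos (2 * x₀) (by positivity)
      exact div_le_div₀ (by positivity) (Real.rpow_le_rpow_of_nonpos hx₀ hy (by linarith)) h2
        (hanti hy2)
  have hO : (fun x : ℝ => x ^ (-σ)) =O[atTop] U := by
    refine Asymptotics.IsBigO.of_bound (x₀ ^ (-σ) / U (2 * x₀)) ?_
    filter_upwards [eventually_ge_atTop x₀] with x hx
    have hx0 : 0 < x := hx₀.trans_le hx
    rw [Real.norm_of_nonneg (hpos x hx0).le, Real.norm_of_nonneg (by positivity)]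
    exact (div_le_iff₀ (hpos x hx0)).1 (hb x hx)
  refine Asymptotics.IsLittleO.trans_isBigO ?_ hO
  exact rpow_isLittleO_rpow_atTop (by linarith)

end RegularlyVaryingAtTop

/-! ### Elementary inequalities -/

/-- A discrete comparison with ∫ t^(-θ) dt; the induction step is Bernoulli's inequality for the
concave power 1 - θ at -1/(K+1). -/
theorem sum_range_rpow_neg_le {θ : ℝ} (hθ0 : 0 ≤ θ) (hθ1 : θ < 1) (K : ℕ) :
    ∑ j ∈ Finset.range K, ((j : ℝ) + 1) ^ (-θ) ≤ (K : ℝ) ^ (1 - θ) / (1 - θ) := by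
  have h1 : 0 < 1 - θ := by linarith
  induction K with
  | zero => simp [Real.zero_rpow h1.ne']
  | succ K ih =>
    rw [Finset.sum_range_succ]
    have hK : (0 : ℝ) < K + 1 := by positivity
    have hB := rpow_one_add_le_one_add_mul_self (s := -1 / ((K : ℝ) + 1))
      (by rw [le_div_iff₀ hK]; nlinarith [(Nat.cast_nonneg K : (0:ℝ) ≤ K)]) h1.le (by linarith)
    have e : 1 + -1 / ((K : ℝ) + 1) = K / (K + 1) := by field_simp; ring
    rw [e, Real.div_rpow (Nat.cast_nonneg K) hK.le, div_le_iff₀ (by positivity)] at hB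
    have e2 : ((K : ℝ) + 1) ^ (-θ) = ((K : ℝ) + 1) ^ (1 - θ) / (K + 1) := by
      rw [show -θ = (1 - θ) - 1 by ring, Real.rpow_sub_one hK.ne']
    rw [le_div_iff₀ h1] at ih ⊢
    push_cast
    rw [add_mul, e2]
    calc _ ≤ (1 + (1 - θ) * (-1 / ((K:ℝ) + 1))) * ((K:ℝ) + 1) ^ (1 - θ)
            + ((K : ℝ) + 1) ^ (1 - θ) / (K + 1) * (1 - θ) := by linarith
      _ = _ := by field_simp; ring

theorem Real.exp_le_one_add_add_sq_mul_exp {u : ℝ} (hu : 0 ≤ u) :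
    Real.exp u ≤ 1 + u + u ^ 2 * Real.exp u := by
  have h := Real.add_one_le_exp (-u)
  have h2 : Real.exp (-u) * Real.exp u = 1 := by rw [← Real.exp_add]; simp
  have h3 : Real.exp u - 1 ≤ u * Real.exp u := by nlinarith [Real.exp_pos u]
  nlinarith

/-- Truncation trades the second moment for one of order s ≤ 2: y² ≤ T^(2-s) w^s for y = min w T.
Absorbing (hT)² into 2 exp(hT) produces the factor exp(2hT). -/
theorem exp_mul_min_le {h w T s : ℝ} (hh : 0 ≤ h) (hw : 0 ≤ w) (hT : 0 < T) (hs1 : 0 ≤ s)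
    (hs2 : s ≤ 2) :
    Real.exp (h * min w T) ≤ 1 + h * w + 2 * Real.exp (2 * (h * T)) / T ^ s * w ^ s := by
  have hy0 : 0 ≤ min w T := le_min hw hT.le
  have hyw : min w T ≤ w := min_le_left _ _
  have hyT : min w T ≤ T := min_le_right _ _
  set y := min w T
  have h1 := Real.exp_le_one_add_add_sq_mul_exp (mul_nonneg hh hy0)
  have h2 : y ^ 2 ≤ T ^ 2 * (w ^ s / T ^ s) := by
    have e : y ^ 2 = y ^ s * y ^ (2 - s) := by
      rw [← Real.rpow_add_of_nonneg hy0 hs1 (by linarith)]; norm_num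
    have e' : T ^ 2 = T ^ s * T ^ (2 - s) := by
      rw [← Real.rpow_add_of_nonneg hT.le hs1 (by linarith)]; norm_num
    have : y ^ s * y ^ (2 - s) ≤ w ^ s * T ^ (2 - s) := by
      gcongr
    rw [e, e']
    have hTs : T ^ s ≠ 0 := (Real.rpow_pos_of_pos hT s).ne'
    calc _ ≤ _ := this
      _ = _ := by field_simp
  have h3 : (h * T) ^ 2 ≤ 2 * Real.exp (h * T) := by
    have := Real.quadratic_le_exp_of_nonneg (mul_nonneg hh hT.le)
    nlinarith [mul_nonneg hh hT.le]
  have hTs : 0 < T ^ s := Real.rpow_pos_of_pos hT s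
  have hws : 0 ≤ w ^ s := Real.rpow_nonneg hw s
  have h4 : (h * y) ^ 2 * Real.exp (h * y) ≤ 2 * Real.exp (2 * (h * T)) / T ^ s * w ^ s := by
    calc (h * y) ^ 2 * Real.exp (h * y)
        ≤ (h ^ 2 * (T ^ 2 * (w ^ s / T ^ s))) * Real.exp (h * T) := by
          rw [mul_pow]; gcongr
      _ = (h * T) ^ 2 * (w ^ s / T ^ s) * Real.exp (h * T) := by ring
      _ ≤ 2 * Real.exp (h * T) * (w ^ s / T ^ s) * Real.exp (h * T) := by gcongr
      _ = 2 * (Real.exp (h * T) * Real.exp (h * T)) / T ^ s * w ^ s := by ring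
      _ = _ := by rw [← Real.exp_add, two_mul (h * T)]
  have h5 : h * y ≤ h * w := by gcongr
  linarith

/-! ### Chernoff bounds for truncated sums -/

section Chernoff

variable {Ω : Type*} [MeasurableSpace Ω] {P : Measure Ω} [IsProbabilityMeasure P]

theorem integrable_exp_mul_min {W : Ω → ℝ} (hW : Measurable W) {h T : ℝ}
    (hh : 0 ≤ h) : Integrable (fun ω => Real.exp (h * min (W ω) T)) P := by
  refine Integrable.of_bound (C := Real.exp (h * T)) (by fun_prop) (ae_of_all _ fun ω => ?_)
  rw [Real.norm_of_nonneg (Real.exp_pos _).le]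
  gcongr
  exact min_le_right _ _

theorem mgf_min_le {W : Ω → ℝ} (hW : Measurable W) (hW0 : ∀ ω, 0 ≤ W ω) (hint : Integrable W P)
    {h T s : ℝ} (hints : Integrable (fun ω => W ω ^ s) P) (hh : 0 ≤ h) (hT : 0 < T) (hs1 : 0 ≤ s)
    (hs2 : s ≤ 2) :
    mgf (fun ω => min (W ω) T) P h ≤
      Real.exp (h * ∫ ω, W ω ∂P + 2 * Real.exp (2 * (h * T)) / T ^ s * ∫ ω, W ω ^ s ∂P) := by
  refine le_trans ?_ (Real.add_one_le_exp _)
  have i1 : Integrable (fun ω => 1 + h * W ω) P := (integrable_const _).add (hint.const_mul h)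
  have i2 := hints.const_mul (2 * Real.exp (2 * (h * T)) / T ^ s)
  calc mgf (fun ω => min (W ω) T) P h
      ≤ ∫ ω, (1 + h * W ω + 2 * Real.exp (2 * (h * T)) / T ^ s * W ω ^ s) ∂P :=
        integral_mono (integrable_exp_mul_min hW hh) (i1.add i2)
          fun ω => exp_mul_min_le hh (hW0 ω) hT hs1 hs2
    _ = _ := by
        rw [integral_add i1 i2, integral_add (integrable_const _) (hint.const_mul h),
          integral_const_mul, integral_const_mul]
        simp; ring

/-- A Chernoff bound for sums of truncated independent identically distributed variables. -/
theorem measureReal_sum_min_ge_le {W : ℕ → Ω → ℝ} (hW : ∀ i, Measurable (W i))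
    (hW0 : ∀ i ω, 0 ≤ W i ω) (hind : iIndepFun W P) (hid : ∀ i, IdentDistrib (W i) (W 0) P P)
    (hint : Integrable (W 0) P) {h T s : ℝ} (hints : Integrable (fun ω => W 0 ω ^ s) P)
    (hh : 0 ≤ h) (hT : 0 < T) (hs1 : 0 ≤ s) (hs2 : s ≤ 2) (K : ℕ) (x : ℝ) :
    P.real {ω | x ≤ ∑ i ∈ Finset.range K, min (W i ω) T} ≤
      Real.exp (-h * x + K * (h * ∫ ω, W 0 ω ∂P
        + 2 * Real.exp (2 * (h * T)) / T ^ s * ∫ ω, W 0 ω ^ s ∂P)) := by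
  have hg : Measurable fun y : ℝ => min y T := by fun_prop
  have hmeas : ∀ i, Measurable fun ω => min (W i ω) T := fun i => hg.comp (hW i)
  have hind' : iIndepFun (fun i ω => min (W i ω) T) P := hind.comp (fun _ y => min y T) fun _ => hg
  have hmgf := hind'.mgf_sum (t := h) hmeas (Finset.range K)
  have hsum : (∑ i ∈ Finset.range K, fun ω => min (W i ω) T)
      = fun ω => ∑ i ∈ Finset.range K, min (W i ω) T := by ext; simp
  rw [hsum] at hmgf
  have hone : ∀ i, mgf (fun ω => min (W i ω) T) P h = mgf (fun ω => min (W 0 ω) T) P h :=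
    fun i => ((hid i).comp ((hg.const_mul h).exp)).integral_eq
  simp only [hone, Finset.prod_const, Finset.card_range] at hmgf
  have hint' : Integrable (fun ω => Real.exp (h * ∑ i ∈ Finset.range K, min (W i ω) T)) P := by
    refine Integrable.of_bound (C := Real.exp (h * ∑ i ∈ Finset.range K, T))
      (by fun_prop) (ae_of_all _ fun ω => ?_)
    rw [Real.norm_of_nonneg (Real.exp_pos _).le]
    gcongr
    exact min_le_right _ _
  refine (measure_ge_le_exp_mul_mgf x hh hint').trans ?_
  rw [hmgf, Real.exp_add, Real.exp_nat_mul]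
  gcongr
  · exact mgf_nonneg
  · exact mgf_min_le (hW 0) (hW0 0) hint hints hh hT hs1 hs2

/-- The truncated sum has mean at most (1-δ)x, so reaching x costs a factor exp(-δhx) up to
constants. Taking h of order log x / x makes this a power of x, as negative as desired once η is
small. -/
theorem isBigO_measureReal_sum_min_ge {W : ℕ → Ω → ℝ} (hW : ∀ i, Measurable (W i))
    (hW0 : ∀ i ω, 0 ≤ W i ω) (hind : iIndepFun W P) (hid : ∀ i, IdentDistrib (W i) (W 0) P P)
    (hint : Integrable (W 0) P) (hm : 0 < ∫ ω, W 0 ω ∂P) {κ : ℝ} (hκ : 0 < κ) (hκ' : 2 * κ ≤ 1)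
    (hints : Integrable (fun ω => W 0 ω ^ (1 + 2 * κ)) P) {δ : ℝ} (hδ : 0 < δ) (hδ1 : δ < 1)
    {N : ℝ} (hN : 0 < N) :
    ∃ η : ℝ, 0 < η ∧
      (fun x : ℝ => P.real {ω | x ≤ ∑ i ∈ Finset.range ⌊(1 - δ) * x / ∫ ω, W 0 ω ∂P⌋₊,
        min (W i ω) (η * x)}) =O[atTop] fun x : ℝ => x ^ (-N) := by
  set m := ∫ ω, W 0 ω ∂P
  set M := ∫ ω, W 0 ω ^ (1 + 2 * κ) ∂P
  have hM : 0 ≤ M := integral_nonneg fun ω => Real.rpow_nonneg (hW0 0 ω) _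
  -- With the h chosen below, exp(-δhx) = (ηx)^(-κδ/η), whose exponent is thus -N.
  set η := κ * δ / N with hη_def
  have hη : 0 < η := by positivity
  refine ⟨η, hη, Asymptotics.IsBigO.of_bound
    (Real.exp ((1 - δ) / m * (2 * M / η)) * η ^ (-N)) ?_⟩
  filter_upwards [eventually_gt_atTop 0, eventually_ge_atTop (1 / η)] with x hx hx1
  have hT : 0 < η * x := by positivity
  have hT1 : 1 ≤ η * x := by rw [div_le_iff₀ hη] at hx1; linarith
  have hlog : 0 ≤ Real.log (η * x) := Real.log_nonneg hT1
  -- For T = ηx this gives exp(2hT) = T^(2κ), so the moment term collapses to 2M/T and stays bounded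
  -- after multiplication by K = O(x).
  set h := κ * Real.log (η * x) / (η * x) with hh_def
  have hh : 0 ≤ h := by positivity
  have hK : (⌊(1 - δ) * x / m⌋₊ : ℝ) ≤ (1 - δ) * x / m :=
    Nat.floor_le (by have : 0 < 1 - δ := by linarith
                     positivity)
  rw [Real.norm_of_nonneg measureReal_nonneg, Real.norm_of_nonneg (by positivity)]
  refine (measureReal_sum_min_ge_le hW hW0 hind hid hint hints hh hT (by positivity)
    (by linarith) _ x).trans ?_
  have hhT : h * (η * x) = κ * Real.log (η * x) := by rw [hh_def]; field_simp
  have e1 : 2 * Real.exp (2 * (h * (η * x))) / (η * x) ^ (1 + 2 * κ) = 2 / (η * x) := by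
    rw [hhT, Real.rpow_add hT, Real.rpow_one, Real.rpow_def_of_pos hT,
      show 2 * (κ * Real.log (η * x)) = Real.log (η * x) * (2 * κ) by ring]
    field_simp
  rw [e1, mul_assoc, ← Real.mul_rpow hη.le hx.le, Real.rpow_def_of_pos hT (-N), ← Real.exp_add]
  refine Real.exp_le_exp.2 ?_
  calc -h * x + ⌊(1 - δ) * x / m⌋₊ * (h * m + 2 / (η * x) * M)
      ≤ -h * x + (1 - δ) * x / m * (h * m + 2 / (η * x) * M) := by gcongr
    _ = -(h * x) * δ + (1 - δ) / m * (2 * M / η) := by field_simp; ring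
    _ = _ := by
      have : h * x = κ * Real.log (η * x) / η := by rw [← hhT]; field_simp
      rw [this, hη_def]; field_simp; ring

end Chernoff

/-! ### Tail ratios and tail estimates -/

/-- The tail `x ↦ P(Y > x)` is asymptotically `a` times the function `U`. -/
def HasTailRatio {Ω : Type*} [MeasurableSpace Ω] (P : Measure Ω) (Y : Ω → ℕ) (U : ℝ → ℝ)
    (a : ℝ) : Prop :=
  Tendsto (fun x : ℝ => P.real {ω | x < (Y ω : ℝ)} / U x) atTop (𝓝 a)

theorem RegularlyVaryingAtTop.eventually_pos {U : ℝ → ℝ} {ρ : ℝ} (hU : RegularlyVaryingAtTop U ρ) :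
    ∀ᶠ x in atTop, 0 < U x :=
  (eventually_gt_atTop 0).mono hU.2.1

/-- A squeeze with slack: x → ∞ at fixed δ first, then δ ↓ 0. -/
theorem tendsto_of_forall_delta {F φ ψ : ℝ → ℝ} {l : ℝ}
    (hφ : Tendsto φ (𝓝[>] 0) (𝓝 l)) (hψ : Tendsto ψ (𝓝[>] 0) (𝓝 l))
    (hup : ∀ δ, 0 < δ → δ < 1 → ∃ G : ℝ → ℝ, Tendsto G atTop (𝓝 (φ δ)) ∧ F ≤ᶠ[atTop] G)
    (hlow : ∀ δ, 0 < δ → δ < 1 → ∃ G : ℝ → ℝ, Tendsto G atTop (𝓝 (ψ δ)) ∧ G ≤ᶠ[atTop] F) :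
    Tendsto F atTop (𝓝 l) := by
  have h01 : ∀ᶠ δ : ℝ in 𝓝[>] 0, 0 < δ ∧ δ < 1 := Ioo_mem_nhdsGT one_pos
  refine tendsto_order.2 ⟨fun b hb => ?_, fun b hb => ?_⟩
  · obtain ⟨δ, hδ, h0, h1⟩ := ((hψ.eventually_const_lt hb).and h01).exists
    obtain ⟨G, hG, hle⟩ := hlow δ h0 h1
    filter_upwards [hG.eventually_const_lt hδ, hle] with x hx hx' using hx.trans_le hx'
  · obtain ⟨δ, hδ, h0, h1⟩ := ((hφ.eventually_lt_const hb).and h01).exists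
    obtain ⟨G, hG, hle⟩ := hup δ h0 h1
    filter_upwards [hG.eventually_lt_const hδ, hle] with x hx hx' using hx'.trans_lt hx

theorem HasTailRatio.comp_mul {Ω : Type*} [MeasurableSpace Ω] {P : Measure Ω} {U : ℝ → ℝ} {γ : ℝ}
    {Y : Ω → ℕ} {a : ℝ} (hY : HasTailRatio P Y U a)
    (hU : RegularlyVaryingAtTop U (-γ)) {c : ℝ} (hc : 0 < c) :
    Tendsto (fun x : ℝ => P.real {ω | c * x < (Y ω : ℝ)} / U x) atTop (𝓝 (a * c ^ (-γ))) := by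
  have hcx : Tendsto (fun x : ℝ => c * x) atTop atTop := tendsto_id.const_mul_atTop hc
  refine ((hY.comp hcx).mul (hU.2.2 c hc)).congr' ?_
  filter_upwards [hcx.eventually hU.eventually_pos] with x hx
  simp only [Function.comp]
  exact div_mul_div_cancel₀ hx.ne'

section

variable {Ω : Type*} [MeasurableSpace Ω] {P : Measure Ω} [IsProbabilityMeasure P]
  {U : ℝ → ℝ} {γ : ℝ}

theorem measureReal_lt_le_rpow {W : Ω → ℝ} (hW0 : ∀ ω, 0 ≤ W ω) {r : ℝ} (hr : 0 ≤ r)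
    (hint : Integrable (fun ω => W ω ^ r) P) {T : ℝ} (hT : 0 < T) :
    P.real {ω | T < W ω} ≤ (∫ ω, W ω ^ r ∂P) * T ^ (-r) := by
  have h := mul_meas_ge_le_integral_of_nonneg
    (ae_of_all P fun ω => Real.rpow_nonneg (hW0 ω) r) hint (T ^ r)
  have hTr : 0 < T ^ r := Real.rpow_pos_of_pos hT r
  have h2 : P.real {ω | T < W ω} ≤ P.real {ω | T ^ r ≤ W ω ^ r} :=
    measureReal_mono fun ω hω => Real.rpow_le_rpow hT.le (le_of_lt hω) hr
  rw [Real.rpow_neg hT.le, ← div_eq_mul_inv, le_div_iff₀ hTr]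
  nlinarith

/-- The shift j + 1 avoids j = 0, where the convention 0^(-θ) = 0 for θ ≠ 0 would make the bound
false in general. The option θ = 0 is needed when γ = 0. -/
theorem HasTailRatio.exists_nat_tail_le {Y : Ω → ℕ} {a : ℝ} (hY : HasTailRatio P Y U a)
    (hU : RegularlyVaryingAtTop U (-γ)) (hanti : Antitone U) {θ : ℝ} (hθ0 : 0 ≤ θ)
    (hθ : θ = 0 ∨ θ < γ) :
    ∃ C : ℝ, 0 ≤ C ∧ ∀ j : ℕ, P.real {ω | j < Y ω} ≤ C * ((j : ℝ) + 1) ^ (-θ) := by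
  rcases hθ with rfl | hθ
  · exact ⟨1, zero_le_one, fun j => by simp⟩
  have h1 : (fun x : ℝ => P.real {ω | x < (Y ω : ℝ)}) =O[atTop] U := by
    refine Asymptotics.isBigO_of_div_tendsto_nhds ?_ a hY
    filter_upwards [hU.eventually_pos] with x hx h0 using absurd h0 hx.ne'
  have h2 := (h1.trans (hU.isBigO_rpow hanti hθ0 hθ)).comp_tendsto
    (tendsto_natCast_atTop_atTop (R := ℝ))
  have h3 : (fun j : ℕ => (j : ℝ) ^ (-θ)) =O[atTop] fun j : ℕ => ((j : ℝ) + 1) ^ (-θ) := by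
    refine Asymptotics.IsBigO.of_bound (2 ^ θ) ?_
    filter_upwards [eventually_ge_atTop 1] with j hj
    have hj' : (1 : ℝ) ≤ j := by exact_mod_cast hj
    have hj0 : (0 : ℝ) < j := by linarith
    rw [Real.norm_of_nonneg (by positivity), Real.norm_of_nonneg (by positivity)]
    calc (j : ℝ) ^ (-θ) = 2 ^ θ * (2 * (j : ℝ)) ^ (-θ) := by
          rw [Real.mul_rpow two_pos.le hj0.le, ← mul_assoc, ← Real.rpow_add two_pos]; simp
      _ ≤ 2 ^ θ * ((j : ℝ) + 1) ^ (-θ) := by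
          gcongr 2 ^ θ * ?_
          exact Real.rpow_le_rpow_of_nonpos (by positivity) (by linarith) (by linarith)
  obtain ⟨C, hC⟩ := (Asymptotics.isBigO_nat_atTop_iff fun j h0 => absurd h0
    (Real.rpow_pos_of_pos (by positivity : (0 : ℝ) < (j : ℝ) + 1) (-θ)).ne').1 (h2.trans h3)
  refine ⟨max C 0, le_max_right _ _, fun j => ?_⟩
  have h4 := hC j
  have hp : 0 < ((j : ℝ) + 1) ^ (-θ) := Real.rpow_pos_of_pos (by positivity) _
  rw [Real.norm_of_nonneg hp.le] at h4
  simp only [Function.comp, Nat.cast_lt] at h4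
  rw [Real.norm_of_nonneg measureReal_nonneg] at h4
  exact h4.trans (by gcongr; exact le_max_left _ _)

/-- Either θ = 0 works, or θ lies in (γ - (r-1), min γ 1), which is nonempty because r > 1 and r >
γ. -/
theorem exists_moment_exponent {r : ℝ} (hr : max 1 γ < r) :
    ∃ θ : ℝ, 0 ≤ θ ∧ θ < 1 ∧ γ < r - 1 + θ ∧ (θ = 0 ∨ θ < γ) := by
  obtain ⟨h1, h2⟩ := max_lt_iff.1 hr
  by_cases h : γ - (r - 1) < 0
  · exact ⟨0, le_rfl, one_pos, by linarith, Or.inl rfl⟩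
  · have : γ - (r - 1) < min γ 1 := lt_min (by linarith) (by linarith)
    obtain ⟨θ, hθ1, hθ2⟩ := exists_between this
    obtain ⟨h3, h4⟩ := lt_min_iff.1 hθ2
    exact ⟨θ, by linarith, h4, by linarith, Or.inr h3⟩

/-- The tails of Y sum to O(x^(1-θ)) and Markov gives O(x^(-r)); the product is o(U) because r - 1 +
θ > γ. -/
theorem HasTailRatio.isLittleO_sum_tail_mul_tail {Y : Ω → ℕ} {a : ℝ} (hY : HasTailRatio P Y U a)
    (hU : RegularlyVaryingAtTop U (-γ)) (hanti : Antitone U) (hγ : 0 ≤ γ)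
    {W : Ω → ℝ} (hW0 : ∀ ω, 0 ≤ W ω) {r : ℝ} (hr : max 1 γ < r)
    (hint : Integrable (fun ω => W ω ^ r) P) {c η : ℝ} (hc : 0 < c) (hη : 0 < η) :
    (fun x : ℝ => ∑ j ∈ Finset.range ⌊c * x⌋₊, P.real {ω | j < Y ω} * P.real {ω | η * x < W ω})
      =o[atTop] U := by
  obtain ⟨θ, hθ0, hθ1, hθr, hθ⟩ := exists_moment_exponent hr
  have hr1 : 1 < r := (le_max_left _ _).trans_lt hr
  obtain ⟨C, hC0, hC⟩ := hY.exists_nat_tail_le hU hanti hθ0 hθ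
  set M := ∫ ω, W ω ^ r ∂P
  have hM : 0 ≤ M := integral_nonneg fun ω => Real.rpow_nonneg (hW0 ω) _
  refine Asymptotics.IsBigO.trans_isLittleO ?_ (hU.isLittleO_rpow hanti hγ hθr)
  refine Asymptotics.IsBigO.of_bound (C * (c ^ (1 - θ) / (1 - θ)) * (M * η ^ (-r))) ?_
  filter_upwards [eventually_gt_atTop 0] with x hx
  have h1θ : 0 < 1 - θ := by linarith
  rw [Real.norm_of_nonneg (Finset.sum_nonneg fun _ _ => by positivity),
    Real.norm_of_nonneg (by positivity), ← Finset.sum_mul]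
  have hfl : (⌊c * x⌋₊ : ℝ) ≤ c * x := Nat.floor_le (by positivity)
  have h1 : ∑ j ∈ Finset.range ⌊c * x⌋₊, P.real {ω | j < Y ω}
      ≤ C * ((c * x) ^ (1 - θ) / (1 - θ)) := by
    calc _ ≤ ∑ j ∈ Finset.range ⌊c * x⌋₊, C * ((j : ℝ) + 1) ^ (-θ) :=
          Finset.sum_le_sum fun j _ => hC j
      _ = C * ∑ j ∈ Finset.range ⌊c * x⌋₊, ((j : ℝ) + 1) ^ (-θ) := by rw [Finset.mul_sum]
      _ ≤ C * ((⌊c * x⌋₊ : ℝ) ^ (1 - θ) / (1 - θ)) := by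
          gcongr; exact sum_range_rpow_neg_le hθ0 hθ1 _
      _ ≤ _ := by gcongr
  have h2 := measureReal_lt_le_rpow hW0 (by linarith) hint (mul_pos hη hx)
  calc _ ≤ C * ((c * x) ^ (1 - θ) / (1 - θ)) * (M * (η * x) ^ (-r)) := by gcongr
    _ = C * (c ^ (1 - θ) / (1 - θ)) * (M * η ^ (-r)) * (x ^ (1 - θ) * x ^ (-r)) := by
        rw [Real.mul_rpow hc.le hx.le, Real.mul_rpow hη.le hx.le]; ring
    _ = _ := by rw [← Real.rpow_add hx]; ring_nf

end

theorem ProbabilityTheory.IndepFun.measureReal_inter_preimage_eq_mul {Ω α β : Type*}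
    [MeasurableSpace Ω] {P : Measure Ω} [MeasurableSpace α] [MeasurableSpace β] {f : Ω → α} {g : Ω → β} (h : IndepFun f g P)
    {s : Set α} {t : Set β} (hs : MeasurableSet s) (ht : MeasurableSet t) :
    P.real (f ⁻¹' s ∩ g ⁻¹' t) = P.real (f ⁻¹' s) * P.real (g ⁻¹' t) := by
  simp only [measureReal_def, h.measure_inter_preimage_eq_mul s t hs ht, ENNReal.toReal_mul]

/-! ### Two-sided bounds for random sums -/

section

variable {Ω : Type*} [MeasurableSpace Ω] {P : Measure Ω} [IsProbabilityMeasure P]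

/-- Summand j is used exactly when j < Y. If Y ≤ K and no used summand exceeds T, truncation changes
nothing, and extending the sum to K terms only increases it. -/
theorem measureReal_random_sum_le {Y : Ω → ℕ} {ζ : ℕ → Ω → ℕ}
    (hind : IndepFun Y (fun ω i => ζ i ω) P) (hid : ∀ i, IdentDistrib (ζ i) (ζ 0) P P)
    (K : ℕ) (x : ℝ) {T : ℝ} (hT : 0 ≤ T) :
    P.real {ω | x < ((∑ i ∈ Finset.range (Y ω), ζ i ω : ℕ) : ℝ)} ≤
      P.real {ω | K < Y ω}
      + ∑ j ∈ Finset.range K, P.real {ω | j < Y ω} * P.real {ω | T < (ζ 0 ω : ℝ)}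
      + P.real {ω | x ≤ ∑ i ∈ Finset.range K, min (ζ i ω : ℝ) T} := by
  have hsub : {ω | x < ((∑ i ∈ Finset.range (Y ω), ζ i ω : ℕ) : ℝ)} ⊆
      ({ω | K < Y ω} ∪ ⋃ j ∈ Finset.range K, {ω | j < Y ω} ∩ {ω | T < (ζ j ω : ℝ)})
        ∪ {ω | x ≤ ∑ i ∈ Finset.range K, min (ζ i ω : ℝ) T} := by
    intro ω hω
    by_contra hcon
    simp only [Set.mem_union, Set.mem_ofPred_eq, Set.mem_iUnion, Set.mem_inter_iff,
      Finset.mem_range, not_or, not_exists, not_and, not_lt, not_le] at hcon hω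
    obtain ⟨⟨hYK, hsmall⟩, hlt⟩ := hcon
    have h1 : ((∑ i ∈ Finset.range (Y ω), ζ i ω : ℕ) : ℝ)
        ≤ ∑ i ∈ Finset.range K, min (ζ i ω : ℝ) T := by
      push_cast
      calc ∑ i ∈ Finset.range (Y ω), (ζ i ω : ℝ)
          = ∑ i ∈ Finset.range (Y ω), min (ζ i ω : ℝ) T := by
            refine Finset.sum_congr rfl fun i hi => (min_eq_left ?_).symm
            have := Finset.mem_range.1 hi
            exact hsmall i (by omega) this
        _ ≤ _ := Finset.sum_le_sum_of_subset_of_nonneg (Finset.range_mono hYK)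
            fun i _ _ => le_min (Nat.cast_nonneg _) hT
    linarith
  refine (measureReal_mono hsub).trans ((measureReal_union_le _ _).trans ?_)
  gcongr
  refine (measureReal_union_le _ _).trans ?_
  gcongr
  refine (measureReal_biUnion_finset_le _ _).trans (Finset.sum_le_sum fun j _ => le_of_eq ?_)
  have hj : IndepFun Y (ζ j) P := hind.comp measurable_id (measurable_pi_apply j)
  have h1 := hj.measureReal_inter_preimage_eq_mul (s := {n | j < n}) (t := {n : ℕ | T < (n : ℝ)})
    (MeasurableSet.of_discrete) (MeasurableSet.of_discrete)
  have h2 := (hid j).measure_mem_eq (s := {n : ℕ | T < (n : ℝ)}) MeasurableSet.of_discrete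
  have h3 : P.real (ζ j ⁻¹' {n : ℕ | T < (n : ℝ)}) = P.real (ζ 0 ⁻¹' {n : ℕ | T < (n : ℝ)}) := by
    simp only [measureReal_def, h2]
  rw [h3] at h1
  exact h1

theorem le_measureReal_random_sum {Y : Ω → ℕ} {ζ : ℕ → Ω → ℕ}
    (hind : IndepFun Y (fun ω i => ζ i ω) P) (K : ℕ) (x : ℝ) :
    P.real {ω | K ≤ Y ω} * P.real {ω | x < ∑ i ∈ Finset.range K, (ζ i ω : ℝ)} ≤
      P.real {ω | x < ((∑ i ∈ Finset.range (Y ω), ζ i ω : ℕ) : ℝ)} := by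
  have hg : Measurable fun z : ℕ → ℕ => ∑ i ∈ Finset.range K, (z i : ℝ) := by fun_prop
  have h := (hind.comp measurable_id hg).measureReal_inter_preimage_eq_mul
    (s := {n | K ≤ n}) (t := Set.Ioi x) MeasurableSet.of_discrete measurableSet_Ioi
  refine h.symm.le.trans (measureReal_mono ?_)
  rintro ω ⟨h1, h2⟩
  simp only [Set.mem_preimage, Function.comp, id, Set.mem_ofPred_eq, Set.mem_Ioi] at h1 h2 ⊢
  refine h2.trans_le ?_
  push_cast
  exact Finset.sum_le_sum_of_subset_of_nonneg (Finset.range_mono h1)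
    fun i _ _ => Nat.cast_nonneg _

/-- A form of the weak law of large numbers. -/
theorem tendsto_measureReal_lt_sum {W : ℕ → Ω → ℝ} (hW : ∀ i, Measurable (W i))
    (hind : iIndepFun W P) (hid : ∀ i, IdentDistrib (W i) (W 0) P P)
    (hint : Integrable (W 0) P) {c : ℝ} (hc : c < ∫ ω, W 0 ω ∂P) :
    Tendsto (fun K : ℕ => P.real {ω | c * K < ∑ i ∈ Finset.range K, W i ω}) atTop (𝓝 1) := by
  have hae := strong_law_ae_real W hint (fun i j hij => hind.indepFun hij) hid
  have hmeas : ∀ K : ℕ, Measurable fun ω => (∑ i ∈ Finset.range K, W i ω) / (K : ℝ) := by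
    intro K; fun_prop
  have hp := tendstoInMeasure_iff_measureReal_dist.1
    (tendstoInMeasure_of_tendsto_ae (fun K => (hmeas K).aestronglyMeasurable) hae)
    _ (sub_pos.2 hc)
  have h1 := hp.const_sub 1
  rw [sub_zero] at h1
  refine tendsto_of_tendsto_of_tendsto_of_le_of_le' h1 tendsto_const_nhds ?_
    (Eventually.of_forall fun K => measureReal_le_one)
  filter_upwards [eventually_gt_atTop 0] with K hK
  have hK' : (0 : ℝ) < K := by exact_mod_cast hK
  have hms : MeasurableSet {ω | c * K < ∑ i ∈ Finset.range K, W i ω} :=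
    measurableSet_lt measurable_const (by fun_prop)
  rw [sub_le_iff_le_add, ← probReal_add_probReal_compl (μ := P) hms]
  refine add_le_add le_rfl (measureReal_mono fun ω hω => ?_)
  simp only [Set.mem_compl_iff, Set.mem_ofPred_eq, not_lt] at hω ⊢
  rw [Real.dist_eq]
  have : (∑ i ∈ Finset.range K, W i ω) / (K : ℝ) ≤ c := (div_le_iff₀ hK').2 hω
  exact le_trans (by linarith) (neg_le_abs _)

end

/-! ### Closure properties of tail ratios -/

section

variable {Ω : Type*} [MeasurableSpace Ω] {P : Measure Ω} [IsProbabilityMeasure P]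
  {U : ℝ → ℝ} {γ : ℝ}

theorem ProbabilityTheory.integrable_rpow_of_le {W : Ω → ℝ} (hW : Measurable W)
    (hW0 : ∀ ω, 0 ≤ W ω) {r s : ℝ} (hs : 0 ≤ s) (hsr : s ≤ r)
    (hint : Integrable (fun ω => W ω ^ r) P) : Integrable (fun ω => W ω ^ s) P := by
  refine ((integrable_const (1 : ℝ)).add hint).mono' (by fun_prop) (ae_of_all _ fun ω => ?_)
  rw [Real.norm_of_nonneg (Real.rpow_nonneg (hW0 ω) s), Pi.add_apply]
  rcases le_total (W ω) 1 with h | h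
  · have := Real.rpow_le_one (hW0 ω) h hs
    have := Real.rpow_nonneg (hW0 ω) r
    linarith
  · have := Real.rpow_le_rpow_of_exponent_le h hsr
    linarith

theorem HasTailRatio.random_sum {Y : Ω → ℕ} {a : ℝ} (hY : HasTailRatio P Y U a)
    (hU : RegularlyVaryingAtTop U (-γ)) (hanti : Antitone U) (hγ : 0 ≤ γ)
    {ζ : ℕ → Ω → ℕ} (hYζ : IndepFun Y (fun ω i => ζ i ω) P)
    (hζ : ∀ i, Measurable (ζ i)) (hind : iIndepFun ζ P)
    (hid : ∀ i, IdentDistrib (ζ i) (ζ 0) P P) (hm : 0 < ∫ ω, (ζ 0 ω : ℝ) ∂P)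
    {r : ℝ} (hr : max 1 γ < r) (hint : Integrable (fun ω => (ζ 0 ω : ℝ) ^ r) P) :
    HasTailRatio P (fun ω => ∑ i ∈ Finset.range (Y ω), ζ i ω) U
      (a * (∫ ω, (ζ 0 ω : ℝ) ∂P) ^ γ) := by
  have hr1 : 1 < r := (le_max_left _ _).trans_lt hr
  have hcast : Measurable (fun n : ℕ => (n : ℝ)) := measurable_of_countable _
  have hWm : ∀ i, Measurable fun ω => (ζ i ω : ℝ) := fun i => hcast.comp (hζ i)
  have hW0 : ∀ i ω, (0 : ℝ) ≤ ζ i ω := fun i ω => Nat.cast_nonneg _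
  have hWind : iIndepFun (fun i ω => (ζ i ω : ℝ)) P :=
    hind.comp (fun _ (n : ℕ) => (n : ℝ)) fun _ => hcast
  have hWid : ∀ i, IdentDistrib (fun ω => (ζ i ω : ℝ)) (fun ω => (ζ 0 ω : ℝ)) P P :=
    fun i => (hid i).comp hcast
  have hint1 : Integrable (fun ω => (ζ 0 ω : ℝ)) P := by
    simpa using integrable_rpow_of_le (hWm 0) (hW0 0) zero_le_one hr1.le hint
  set m := ∫ ω, (ζ 0 ω : ℝ) ∂P with hm_def
  have hpow : a * (1 / m) ^ (-γ) = a * m ^ γ := by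
    rw [one_div, Real.inv_rpow hm.le, Real.rpow_neg hm.le, inv_inv]
  -- The sign σ = -1 serves the upper bound and σ = 1 the lower one.
  have hcont : ∀ σ : ℝ, Tendsto (fun δ : ℝ => a * ((1 + σ * δ) / m) ^ (-γ)) (𝓝[>] 0)
      (𝓝 (a * m ^ γ)) := by
    intro σ
    rw [← hpow]
    have : ContinuousAt (fun δ : ℝ => a * ((1 + σ * δ) / m) ^ (-γ)) 0 := by
      refine continuousAt_const.mul (ContinuousAt.rpow_const (by fun_prop) (Or.inl ?_))
      simp [hm.ne']
    have h := this.tendsto.mono_left (nhdsWithin_le_nhds (s := Set.Ioi 0))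
    simpa using h
  refine tendsto_of_forall_delta (hcont (-1)) (hcont 1) ?_ ?_
  · intro δ hδ0 hδ1
    have hδ : 0 < 1 - δ := by linarith
    -- The moment order 1 + 2κ must be at most 2 for the truncation estimate and at most r for
    -- integrability.
    obtain ⟨κ, hκ, hκ1, hκr⟩ : ∃ κ : ℝ, 0 < κ ∧ 2 * κ ≤ 1 ∧ 1 + 2 * κ ≤ r :=
      ⟨min 1 (r - 1) / 2, by have : 0 < min 1 (r - 1) := lt_min one_pos (by linarith)
                             positivity,
        by linarith [min_le_left 1 (r - 1)], by linarith [min_le_right 1 (r - 1)]⟩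
    obtain ⟨η, hη, hO⟩ := isBigO_measureReal_sum_min_ge hWm hW0 hWind hWid hint1 hm hκ hκ1
      (integrable_rpow_of_le (hWm 0) (hW0 0) (by positivity) hκr hint) hδ0 hδ1
      (N := γ + 1) (by linarith)
    rw [← hm_def] at hO
    have hc : 0 < (1 - δ) / m := by positivity
    have t1 := hY.comp_mul hU hc
    have t2 := (hY.isLittleO_sum_tail_mul_tail hU hanti hγ (hW0 0) hr hint hc
      hη).tendsto_div_nhds_zero
    have t3 := (hO.trans_isLittleO
      (hU.isLittleO_rpow hanti hγ (by linarith))).tendsto_div_nhds_zero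
    have e0 : 1 + -1 * δ = 1 - δ := by ring
    refine ⟨_, by simpa only [e0, add_zero] using (t1.add t2).add t3, ?_⟩
    filter_upwards [eventually_gt_atTop 0] with x hx
    have hUx := hU.2.1 x hx
    have key := measureReal_random_sum_le hYζ hid ⌊(1 - δ) / m * x⌋₊ x (mul_pos hη hx).le
    have e1 : {ω | ⌊(1 - δ) / m * x⌋₊ < Y ω} = {ω | (1 - δ) / m * x < Y ω} := by
      ext ω; exact Nat.floor_lt (by positivity)
    have e2 : (1 - δ) / m * x = (1 - δ) * x / m := by ring
    rw [e1] at key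
    rw [← add_div, ← add_div]
    gcongr
    simpa only [e2] using key
  · intro δ hδ0 hδ1
    have hc : 0 < (1 + 1 * δ) / m := by positivity
    have t1 := hY.comp_mul hU hc
    have hceil : Tendsto (fun x : ℝ => ⌈(1 + 1 * δ) / m * x⌉₊) atTop atTop :=
      tendsto_nat_ceil_atTop.comp (tendsto_id.const_mul_atTop hc)
    -- With K ≥ (1+δ)x/m, a sum of K terms above Km/(1+δ) exceeds x; this level per term is below
    -- the mean, so the law of large numbers applies.
    have hcm : m / (1 + 1 * δ) < m := div_lt_self hm (by linarith)
    have t2 := (tendsto_measureReal_lt_sum hWm hWind hWid hint1 hcm).comp hceil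
    refine ⟨_, by simpa only [mul_one] using t1.mul t2, ?_⟩
    filter_upwards [eventually_gt_atTop 0] with x hx
    have hUx := hU.2.1 x hx
    have key := le_measureReal_random_sum hYζ ⌈(1 + 1 * δ) / m * x⌉₊ x
    rw [div_mul_eq_mul_div]
    gcongr
    refine le_trans ?_ key
    refine mul_le_mul (measureReal_mono fun ω hω => Nat.ceil_le.2 (le_of_lt hω))
      (measureReal_mono fun ω hω => ?_) measureReal_nonneg measureReal_nonneg
    · simp only [Set.mem_ofPred_eq] at hω ⊢
      refine lt_of_le_of_lt ?_ hω
      have := Nat.le_ceil ((1 + 1 * δ) / m * x)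
      calc x = m / (1 + 1 * δ) * ((1 + 1 * δ) / m * x) := by field_simp
        _ ≤ _ := by gcongr

theorem HasTailRatio.add {A B : Ω → ℕ} {a b : ℝ} (hA : HasTailRatio P A U a)
    (hB : HasTailRatio P B U b) (hmB : Measurable B)
    (hU : RegularlyVaryingAtTop U (-γ)) (hU0 : Tendsto U atTop (𝓝 0)) (hAB : IndepFun A B P) :
    HasTailRatio P (fun ω => A ω + B ω) U (a + b) := by
  have hprod : ∀ x : ℝ, P.real ({ω | x < (A ω : ℝ)} ∩ {ω | x < (B ω : ℝ)})
      = P.real {ω | x < (A ω : ℝ)} * P.real {ω | x < (B ω : ℝ)} := fun x =>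
    hAB.measureReal_inter_preimage_eq_mul (s := {n : ℕ | x < (n : ℝ)})
      (t := {n : ℕ | x < (n : ℝ)}) MeasurableSet.of_discrete MeasurableSet.of_discrete
  have hcross : ∀ c : ℝ, 0 < c → Tendsto (fun x : ℝ =>
      P.real {ω | c * x < (A ω : ℝ)} * P.real {ω | c * x < (B ω : ℝ)} / U x) atTop (𝓝 0) := by
    intro c hc
    have h := ((hA.comp_mul hU hc).mul (hB.comp_mul hU hc)).mul hU0
    rw [mul_zero] at h
    refine h.congr' ?_
    filter_upwards [hU.eventually_pos] with x hx
    field_simp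
  have hcont : Tendsto (fun δ : ℝ => a * (1 - δ) ^ (-γ) + b * (1 - δ) ^ (-γ)) (𝓝[>] 0)
      (𝓝 (a + b)) := by
    have : ContinuousAt (fun δ : ℝ => a * (1 - δ) ^ (-γ) + b * (1 - δ) ^ (-γ)) 0 := by
      have h : ContinuousAt (fun δ : ℝ => (1 - δ) ^ (-γ)) 0 :=
        ContinuousAt.rpow_const (by fun_prop) (Or.inl (by simp))
      exact (continuousAt_const.mul h).add (continuousAt_const.mul h)
    simpa using this.tendsto.mono_left (nhdsWithin_le_nhds (s := Set.Ioi 0))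
  refine tendsto_of_forall_delta hcont (tendsto_const_nhds (x := a + b)) ?_ ?_
  · intro δ hδ0 hδ1
    have hδ : 0 < 1 - δ := by linarith
    refine ⟨_, by simpa using ((hA.comp_mul hU hδ).add (hB.comp_mul hU hδ)).add (hcross δ hδ0), ?_⟩
    filter_upwards [eventually_gt_atTop 0] with x hx
    have hUx := hU.2.1 x hx
    rw [← add_div, ← add_div, ← hprod]
    gcongr
    -- If neither summand exceeds (1-δ)x, then each must exceed δx.
    have hsub : {ω | x < ((A ω + B ω : ℕ) : ℝ)} ⊆
        ({ω | (1 - δ) * x < (A ω : ℝ)} ∪ {ω | (1 - δ) * x < (B ω : ℝ)})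
          ∪ ({ω | δ * x < (A ω : ℝ)} ∩ {ω | δ * x < (B ω : ℝ)}) := by
      intro ω hω
      by_contra hcon
      simp only [Set.mem_union, Set.mem_inter_iff, Set.mem_ofPred_eq, not_or, not_and,
        not_lt, Nat.cast_add] at hcon hω
      obtain ⟨⟨h1, h2⟩, h3⟩ := hcon
      by_cases h : δ * x < A ω
      · linarith [h3 h]
      · linarith
    refine (measureReal_mono hsub).trans ((measureReal_union_le _ _).trans ?_)
    gcongr
    exact measureReal_union_le _ _
  · intro δ _ _
    -- Lower bound by inclusion-exclusion: either summand above x suffices, and the overlap is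
    -- negligible.
    have h1 := (Tendsto.add hA hB).sub (hcross 1 one_pos)
    simp only [one_mul, sub_zero] at h1
    refine ⟨_, h1, ?_⟩
    filter_upwards [eventually_gt_atTop 0] with x hx
    have hUx := hU.2.1 x hx
    rw [← add_div, ← sub_div, ← hprod]
    gcongr
    have hms : MeasurableSet {ω | x < (B ω : ℝ)} :=
      hmB (MeasurableSet.of_discrete (s := {n : ℕ | x < (n : ℝ)}))
    rw [sub_le_iff_le_add, ← measureReal_union_add_inter hms]
    refine add_le_add (measureReal_mono ?_) le_rfl
    rintro ω (h | h) <;> simp only [Set.mem_ofPred_eq, Nat.cast_add] at h ⊢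
    · linarith [(Nat.cast_nonneg (B ω) : (0 : ℝ) ≤ B ω)]
    · linarith [(Nat.cast_nonneg (A ω) : (0 : ℝ) ≤ A ω)]

theorem hasTailRatio_zero_of_integrable_rpow {Y : Ω → ℕ} (hU : RegularlyVaryingAtTop U (-γ))
    (hanti : Antitone U) (hγ : 0 ≤ γ) {r : ℝ} (hr : γ < r)
    (hint : Integrable (fun ω => (Y ω : ℝ) ^ r) P) : HasTailRatio P Y U 0 := by
  refine Asymptotics.IsLittleO.tendsto_div_nhds_zero
    (Asymptotics.IsBigO.trans_isLittleO ?_ (hU.isLittleO_rpow hanti hγ hr))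
  refine Asymptotics.IsBigO.of_bound (∫ ω, (Y ω : ℝ) ^ r ∂P) ?_
  filter_upwards [eventually_gt_atTop 0] with x hx
  rw [Real.norm_of_nonneg measureReal_nonneg, Real.norm_of_nonneg (by positivity)]
  exact measureReal_lt_le_rpow (fun ω => Nat.cast_nonneg _) (by linarith) hint hx

theorem tendsto_tail_atTop {Y : Ω → ℕ} (hY : Measurable Y) :
    Tendsto (fun x : ℝ => P.real {ω | x < (Y ω : ℝ)}) atTop (𝓝 0) := by
  have h := tendsto_measure_iInter_atTop (μ := P) (s := fun x : ℝ => {ω | x < (Y ω : ℝ)})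
    (fun x => (hY (MeasurableSet.of_discrete (s := {n : ℕ | x < (n : ℝ)}))).nullMeasurableSet)
    (fun x y hxy ω hω => lt_of_le_of_lt hxy hω) ⟨0, measure_ne_top _ _⟩
  have he : ⋂ x : ℝ, {ω | x < (Y ω : ℝ)} = ∅ := by
    ext ω; simpa using ⟨(Y ω : ℝ), le_rfl⟩
  rw [he, measure_empty] at h
  exact (ENNReal.tendsto_toReal ENNReal.zero_ne_top).comp h

theorem antitone_tail {Y : Ω → ℕ} : Antitone fun x : ℝ => P.real {ω | x < (Y ω : ℝ)} :=
  fun _ _ hxy => measureReal_mono fun _ hω => lt_of_le_of_lt hxy hω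

theorem HasTailRatio.regularlyVaryingRV {Y : Ω → ℕ} {a : ℝ} (hY : HasTailRatio P Y U a)
    (hU : RegularlyVaryingAtTop U (-γ)) (ha : 0 < a) :
    RegularlyVaryingRV P (fun ω => (Y ω : ℝ)) γ := by
  have hpos : ∀ᶠ x : ℝ in atTop, 0 < P.real {ω | x < (Y ω : ℝ)} := by
    filter_upwards [hY.eventually_const_lt ha, hU.eventually_pos] with x h1 h2
    exact (div_pos_iff_of_pos_right h2).1 h1
  refine ⟨ae_of_all _ fun ω => Nat.cast_nonneg _,
    (antitone_tail.measurable).comp measurable_subtype_coe, fun x _ => ?_, fun q hq => ?_⟩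
  · obtain ⟨y, hy, hxy⟩ := (hpos.and (eventually_ge_atTop x)).exists
    exact hy.trans_le (antitone_tail hxy)
  · have h := (hY.comp_mul hU hq).div hY ha.ne'
    rw [mul_div_cancel_left₀ _ ha.ne'] at h
    refine h.congr' ?_
    filter_upwards [hU.eventually_pos] with x hx
    simp only [Pi.div_apply]
    exact div_div_div_cancel_right₀ hx.ne' _ _

end

/-! ### Independence structure and induction for the branching process -/

theorem Finset.sum_Icc_one_eq_sum_range (f : ℕ → ℕ) (N : ℕ) :
    ∑ i ∈ Finset.Icc 1 N, f i = ∑ i ∈ Finset.range N, f (i + 1) := by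
  rw [← Finset.Ico_add_one_right_eq_Icc, Finset.sum_Ico_eq_sum_range]
  simp [add_comm]

theorem measurable_random_sum {Ω : Type*} [MeasurableSpace Ω] {Z : Ω → ℕ} {ζ : ℕ → Ω → ℕ}
    (hZ : Measurable Z) (hζ : ∀ i, Measurable (ζ i)) :
    Measurable fun ω => ∑ i ∈ Finset.range (Z ω), ζ i ω := by
  have h : Measurable fun p : ℕ × Ω => ∑ i ∈ Finset.range p.1, ζ i p.2 :=
    measurable_from_prod_countable_right fun n =>
      Finset.measurable_fun_sum (Finset.range n) fun i _ => hζ i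
  exact h.comp (hZ.prodMk measurable_id)

/-- The labels of the variables determining the first `n` generations. -/
def GWILabel.past (n : ℕ) : Set GWILabel :=
  {l | match l with
    | .initial => True
    | .offspring k _ => (k : ℕ) ≤ n
    | .immigration k => (k : ℕ) ≤ n}

theorem GWILabel.offspring_mem_past {n : ℕ} {k i : ℕ+} :
    GWILabel.offspring k i ∈ GWILabel.past n ↔ (k : ℕ) ≤ n := Iff.rfl

theorem GWILabel.immigration_mem_past {n : ℕ} {k : ℕ+} :
    GWILabel.immigration k ∈ GWILabel.past n ↔ (k : ℕ) ≤ n := Iff.rfl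

theorem GWILabel.past_subset_succ (n : ℕ) : GWILabel.past n ⊆ GWILabel.past (n + 1) := by
  rintro (_ | ⟨k, i⟩ | k) h
  · trivial
  · exact Nat.le_succ_of_le h
  · exact Nat.le_succ_of_le h

theorem HasTailRatio.congr {Ω : Type*} [MeasurableSpace Ω] {P : Measure Ω} {Y Z : Ω → ℕ}
    {U : ℝ → ℝ} {a : ℝ} (h : HasTailRatio P Y U a) (hYZ : Y =ᵐ[P] Z) : HasTailRatio P Z U a := by
  refine Tendsto.congr (fun x => ?_) h
  have : P.real {ω | x < (Y ω : ℝ)} = P.real {ω | x < (Z ω : ℝ)} := by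
    refine measureReal_congr (hYZ.mono fun ω hω => ?_)
    exact congrArg (fun n : ℕ => x < (n : ℝ)) hω
  rw [this]

/-- The σ-algebra generated by the variables of the family with labels in `S`. -/
abbrev gwiSigma {Ω : Type*} (X₀ : Ω → ℕ) (ξ : ℕ → ℕ → Ω → ℕ) (ε : ℕ → Ω → ℕ)
    (S : Set GWILabel) : MeasurableSpace Ω :=
  ⨆ l ∈ S, MeasurableSpace.comap (gwiFamily X₀ ξ ε l) inferInstance

section

variable {Ω : Type*} {X₀ : Ω → ℕ} {ξ : ℕ → ℕ → Ω → ℕ} {ε : ℕ → Ω → ℕ}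

theorem gwiSigma_mono {S T : Set GWILabel} (h : S ⊆ T) : gwiSigma X₀ ξ ε S ≤ gwiSigma X₀ ξ ε T :=
  biSup_mono h

theorem measurable_gwiFamily {S : Set GWILabel} {l : GWILabel} (hl : l ∈ S) :
    Measurable[gwiSigma X₀ ξ ε S] (gwiFamily X₀ ξ ε l) :=
  (comap_measurable _).mono (le_biSup (fun l => MeasurableSpace.comap (gwiFamily X₀ ξ ε l) _) hl)
    le_rfl

theorem measurable_gwi_offspring {S : Set GWILabel} {n : ℕ} (i : ℕ)
    (hS : ∀ i, GWILabel.offspring n.succPNat i ∈ S) :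
    Measurable[gwiSigma X₀ ξ ε S] (ξ (n + 1) (i + 1)) :=
  measurable_gwiFamily (X₀ := X₀) (ξ := ξ) (ε := ε) (hS i.succPNat)

theorem measurable_gwi_immigration {S : Set GWILabel} {n : ℕ}
    (hS : GWILabel.immigration n.succPNat ∈ S) :
    Measurable[gwiSigma X₀ ξ ε S] (ε (n + 1)) :=
  measurable_gwiFamily (X₀ := X₀) (ξ := ξ) (ε := ε) hS

end

namespace IsGaltonWatsonWithImmigration

variable {Ω : Type*} [MeasurableSpace Ω] {P : Measure Ω}
  {X : ℕ → Ω → ℕ} {ξ : ℕ → ℕ → Ω → ℕ} {ε : ℕ → Ω → ℕ}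

theorem indepFun_of_disjoint (hX : IsGaltonWatsonWithImmigration P X ξ ε) {S T : Set GWILabel}
    (hST : Disjoint S T) {α β : Type*} [MeasurableSpace α] [MeasurableSpace β] {f : Ω → α}
    {g : Ω → β} (hf : Measurable[gwiSigma (X 0) ξ ε S] f)
    (hg : Measurable[gwiSigma (X 0) ξ ε T] g) : IndepFun f g P := by
  have hle : ∀ l, MeasurableSpace.comap (gwiFamily (X 0) ξ ε l) inferInstance ≤
      (inferInstance : MeasurableSpace Ω) := by
    rintro (_ | ⟨n, i⟩ | n)
    · exact (hX.measurable_process 0).comap_le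
    · exact (hX.measurable_offspring n i n.pos i.pos).comap_le
    · exact (hX.measurable_immigration n n.pos).comap_le
  have h := indep_iSup_of_disjoint hle ((iIndepFun_iff_iIndep _ _ _).1 hX.indep) hST
  rw [IndepFun_iff_Indep]
  exact indep_of_indep_of_le_left (indep_of_indep_of_le_right h hg.comap_le) hf.comap_le

theorem recursion_succ (hX : IsGaltonWatsonWithImmigration P X ξ ε) (n : ℕ) :
    ∀ᵐ ω ∂P, X (n + 1) ω = (∑ i ∈ Finset.range (X n ω), ξ (n + 1) (i + 1) ω) + ε (n + 1) ω := by
  filter_upwards [hX.recursion (n + 1) (by omega)] with ω h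
  rw [h, Nat.add_sub_cancel, Finset.sum_Icc_one_eq_sum_range]

/-- The recursion holds only almost surely, so X n need not be measurable for the σ-algebra of the
past; independence is applied to a version built from the recursion. -/
theorem exists_measurable_past (hX : IsGaltonWatsonWithImmigration P X ξ ε) (n : ℕ) :
    ∃ Z : Ω → ℕ, Measurable[gwiSigma (X 0) ξ ε (GWILabel.past n)] Z ∧ Z =ᵐ[P] X n := by
  induction n with
  | zero => exact ⟨X 0, measurable_gwiFamily (l := .initial) trivial, ae_eq_rfl⟩
  | succ n ih =>
    obtain ⟨Z, hZ, hZX⟩ := ih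
    refine ⟨fun ω => (∑ i ∈ Finset.range (Z ω), ξ (n + 1) (i + 1) ω) + ε (n + 1) ω, ?_, ?_⟩
    · have h1 := @measurable_random_sum _ (gwiSigma (X 0) ξ ε (GWILabel.past (n + 1))) _
        (fun i => ξ (n + 1) (i + 1)) (hZ.mono (gwiSigma_mono (GWILabel.past_subset_succ n)) le_rfl)
        fun i => measurable_gwi_offspring i fun i => GWILabel.offspring_mem_past.2 (by simp)
      have h2 : Measurable[gwiSigma (X 0) ξ ε (GWILabel.past (n + 1))] (ε (n + 1)) :=
        measurable_gwi_immigration (GWILabel.immigration_mem_past.2 (by simp))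
      exact h1.add h2
    · filter_upwards [hZX, hX.recursion_succ n] with ω h1 h2
      rw [h2, h1]

theorem iIndepFun_offspring (hX : IsGaltonWatsonWithImmigration P X ξ ε) (n : ℕ) :
    iIndepFun (fun i => ξ (n + 1) (i + 1)) P := by
  refine hX.indep.precomp (g := fun i : ℕ => GWILabel.offspring n.succPNat i.succPNat) ?_
  intro i j h
  simpa using h

theorem hasTailRatio_succ [IsProbabilityMeasure P] (hX : IsGaltonWatsonWithImmigration P X ξ ε)
    {γ r a : ℝ} (hγ : 0 ≤ γ) (hε : RegularlyVaryingRV P (fun ω => (ε 1 ω : ℝ)) γ)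
    (hm : 0 < ∫ ω, (ξ 1 1 ω : ℝ) ∂P) (hr : max 1 γ < r)
    (hint : Integrable (fun ω => (ξ 1 1 ω : ℝ) ^ r) P) {n : ℕ}
    (hn : HasTailRatio P (X n) (fun x => P.real {ω | x < (ε 1 ω : ℝ)}) a) :
    HasTailRatio P (X (n + 1)) (fun x => P.real {ω | x < (ε 1 ω : ℝ)})
      (a * (∫ ω, (ξ 1 1 ω : ℝ) ∂P) ^ γ + 1) := by
  obtain ⟨Z, hZ, hZX⟩ := hX.exists_measurable_past n
  have hξ : ∀ i, Measurable (ξ (n + 1) (i + 1)) := fun i =>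
    hX.measurable_offspring _ _ (by omega) (by omega)
  have hid : ∀ i, IdentDistrib (ξ (n + 1) (i + 1)) (ξ 1 1) P P := fun i =>
    hX.identDistrib_offspring _ _ (by omega) (by omega)
  have hZξ : IndepFun Z (fun ω i => ξ (n + 1) (i + 1) ω) P := by
    refine hX.indepFun_of_disjoint (T := Set.range (GWILabel.offspring n.succPNat)) ?_ hZ ?_
    · rw [Set.disjoint_left]
      rintro _ h ⟨i, rfl⟩
      exact absurd (show n + 1 ≤ n from h) (by omega)
    · exact @measurable_pi_lambda _ _ _ (gwiSigma _ _ _ _) _ _ fun i =>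
        measurable_gwi_offspring i fun i => ⟨i, rfl⟩
  have hcast : Measurable (fun n : ℕ => (n : ℝ)) := measurable_of_countable _
  have hme : ∫ ω, (ξ (n + 1) (0 + 1) ω : ℝ) ∂P = ∫ ω, (ξ 1 1 ω : ℝ) ∂P :=
    ((hid 0).comp hcast).integral_eq
  have hint' : Integrable (fun ω => (ξ (n + 1) (0 + 1) ω : ℝ) ^ r) P :=
    ((hid 0).comp (hcast.pow_const r)).integrable_iff.2 hint
  have hsum := (hn.congr hZX.symm).random_sum hε.2 antitone_tail hγ
    (ζ := fun i => ξ (n + 1) (i + 1)) hZξ hξ (hX.iIndepFun_offspring n)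
    (fun i => (hid i).trans (hid 0).symm) (hme ▸ hm) hr hint'
  rw [hme] at hsum
  have hεm := hX.measurable_immigration 1 le_rfl
  have hεid := hX.identDistrib_immigration (n + 1) (by omega)
  have himm : HasTailRatio P (ε (n + 1)) (fun x => P.real {ω | x < (ε 1 ω : ℝ)}) 1 := by
    refine tendsto_const_nhds.congr' ?_
    filter_upwards [hε.2.eventually_pos] with x hx
    have h := hεid.measure_mem_eq (s := {n : ℕ | x < (n : ℝ)}) MeasurableSet.of_discrete
    have h' : P.real {ω | x < (ε (n + 1) ω : ℝ)} = P.real {ω | x < (ε 1 ω : ℝ)} :=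
      congrArg ENNReal.toReal h
    rw [h', div_self hx.ne']
  have hindep : IndepFun (fun ω => ∑ i ∈ Finset.range (Z ω), ξ (n + 1) (i + 1) ω) (ε (n + 1)) P := by
    -- The random sum uses both the past and generation n + 1 offspring, all of which avoid this
    -- single immigration label.
    refine hX.indepFun_of_disjoint (S := {GWILabel.immigration n.succPNat}ᶜ)
      (T := {GWILabel.immigration n.succPNat}) disjoint_compl_left ?_
      (measurable_gwi_immigration rfl)
    refine @measurable_random_sum _ (gwiSigma _ _ _ _) _ (fun i => ξ (n + 1) (i + 1))
      (hZ.mono (gwiSigma_mono ?_) le_rfl) fun i => measurable_gwi_offspring i ?_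
    · rintro _ h rfl
      exact absurd (show n + 1 ≤ n from h) (by omega)
    · intro i h
      cases h
  refine (hsum.add himm (hX.measurable_immigration _ (by omega)) hε.2 (tendsto_tail_atTop hεm)
    hindep).congr ?_
  filter_upwards [hZX, hX.recursion_succ n] with ω h1 h2
  rw [h2, h1]

end IsGaltonWatsonWithImmigration

theorem sum_Icc_rpow_succ {m γ : ℝ} (hm : 0 < m) (n : ℕ) :
    ∑ i ∈ Finset.Icc 1 (n + 1), m ^ ((((n + 1 : ℕ) : ℝ) - (i : ℝ)) * γ)
      = (∑ i ∈ Finset.Icc 1 n, m ^ (((n : ℝ) - (i : ℝ)) * γ)) * m ^ γ + 1 := by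
  rw [Finset.sum_Icc_succ_top (by omega), Finset.sum_mul]
  congr 1
  · refine Finset.sum_congr rfl fun i _ => ?_
    rw [← Real.rpow_add hm]
    push_cast
    ring_nf
  · simp

theorem mainTheorem4 {Ω : Type*} [MeasurableSpace Ω] (P : Measure Ω) [IsProbabilityMeasure P]
    (X : ℕ → Ω → ℕ) (ξ : ℕ → ℕ → Ω → ℕ) (ε : ℕ → Ω → ℕ)
    (hX : IsGaltonWatsonWithImmigration P X ξ ε)
    (γ : ℝ) (hγ : 0 ≤ γ)
    (hε : RegularlyVaryingRV P (fun ω => (ε 1 ω : ℝ)) γ)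
    (hξ : P {ω | ξ 1 1 ω = 0} < 1)
    (hr : ∃ r : ℝ, max 1 γ < r ∧
      Integrable (fun ω => (ξ 1 1 ω : ℝ) ^ r) P ∧ Integrable (fun ω => (X 0 ω : ℝ) ^ r) P) :
    ∀ n : ℕ, 1 ≤ n →
      (fun x : ℝ => P.real {ω | x < (X n ω : ℝ)}) ~[atTop]
        (fun x : ℝ => ∑ i ∈ Finset.Icc 1 n,
          (∫ ω, (ξ 1 1 ω : ℝ) ∂P) ^ (((n : ℝ) - (i : ℝ)) * γ) * P.real {ω | x < (ε 1 ω : ℝ)}) ∧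
      RegularlyVaryingRV P (fun ω => (X n ω : ℝ)) γ := by
  obtain ⟨r, hr, hintξ, hint0⟩ := hr
  have hr1 : 1 < r := (le_max_left _ _).trans_lt hr
  have hξm : Measurable fun ω => (ξ 1 1 ω : ℝ) :=
    (measurable_of_countable (fun n : ℕ => (n : ℝ))).comp
      (hX.measurable_offspring 1 1 le_rfl le_rfl)
  have hint1 : Integrable (fun ω => (ξ 1 1 ω : ℝ)) P := by
    simpa using integrable_rpow_of_le hξm (fun ω => Nat.cast_nonneg _) zero_le_one hr1.le hintξ
  have hm : 0 < ∫ ω, (ξ 1 1 ω : ℝ) ∂P := by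
    -- A zero mean would force the offspring variable to vanish almost surely.
    refine lt_of_le_of_ne (integral_nonneg fun ω => Nat.cast_nonneg _) fun h => hξ.ne ?_
    have h0 := (integral_eq_zero_iff_of_nonneg (fun ω => Nat.cast_nonneg _) hint1).1 h.symm
    refine (measure_congr (eventuallyEq_univ.2 ?_)).trans measure_univ
    filter_upwards [h0] with ω hω
    exact Nat.cast_eq_zero.1 hω
  have hmain : ∀ n, HasTailRatio P (X n) (fun x => P.real {ω | x < (ε 1 ω : ℝ)})
      (∑ i ∈ Finset.Icc 1 n, (∫ ω, (ξ 1 1 ω : ℝ) ∂P) ^ (((n : ℝ) - (i : ℝ)) * γ)) := by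
    intro n
    induction n with
    | zero =>
      simpa using hasTailRatio_zero_of_integrable_rpow hε.2 antitone_tail hγ
        ((le_max_right _ _).trans_lt hr) hint0
    | succ n ih =>
      rw [sum_Icc_rpow_succ hm]
      exact hX.hasTailRatio_succ hγ hε hm hr hintξ ih
  intro n hn
  have hpos : 0 < ∑ i ∈ Finset.Icc 1 n,
      (∫ ω, (ξ 1 1 ω : ℝ) ∂P) ^ (((n : ℝ) - (i : ℝ)) * γ) :=
    Finset.sum_pos (fun i _ => Real.rpow_pos_of_pos hm _) ⟨1, by simpa using hn⟩
  refine ⟨?_, (hmain n).regularlyVaryingRV hε.2 hpos⟩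
  simp only [← Finset.sum_mul]
  rw [Asymptotics.isEquivalent_iff_tendsto_one]
  · have h := (hmain n).div_const (∑ i ∈ Finset.Icc 1 n,
      (∫ ω, (ξ 1 1 ω : ℝ) ∂P) ^ (((n : ℝ) - (i : ℝ)) * γ))
    rw [div_self hpos.ne'] at h
    refine h.congr fun x => ?_
    rw [Pi.div_apply, div_div, mul_comm]
  · filter_upwards [hε.2.eventually_pos] with x hx using (mul_pos hpos hx).ne'
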